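/- Let $T$ be a string of length $n$ over a linearly ordered alphabet, let $R\subseteq[0..n)$, and let $x=|R|\ge 2$. A *compact trie* here is the compact trie of finitely many strings (its terminals), each carrying a label in $[0..n)$; it may in addition contain a distinguished rooted *main path*. Its explicit nodes are the root, the terminals, the branching nodes and the end of the main path. The size of a (sub)tree is its number of terminals. A *$k$-errata tree* for the suffixes $T[i..n)$, $i\in R$, consists of collections (with multiplicity) of compact tries at levels $0,\dots,k$. Level $0$ consists of the compact trie of these suffixes, the suffix $T[i..n)$ being labelled $i$. For $i<k$, level $i+1$ consists of all group trees formed from all compact tries $\mathcal T$ of level $i$, as follows. * *Heavy paths.* Every explicit node of $\mathcal T$ that has children has one heavy child: along the main path of $\mathcal T$, if there is one, it is the child on the main path; elsewhere it is a child with a subtree of maximum size, ties being broken arbitrarily. The root and all non-heavy explicit nodes are light. A heavy path starts at a light node and follows heavy children down to a leaf. For an explicit node $v$ and each first character $a$ of an edge from $v$ to a child that is not heavy, the off-path subtree $\mathcal T_{v,a}$ is the subtree of that child together with the edge to it from $v$. * *Substitution trees.* (a) $\mathcal T^s_{v,a}$ is $\mathcal T_{v,a}$ with its first character $a$ replaced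 by a special character $\psi$. (b) For a node $v$ of a heavy path $\pi$ having an off-path subtree, $\mathcal T^s_v$ is the merge of the trees $\mathcal T^s_{v,a}$ over all $a$, with $\psi$ replaced by the character $b$ that follows $v$ on $\pi$, extended upwards by the path from the top of $\pi$ to $v$. Labels of terminals are kept. * *Group trees.* The trees of type (a) are grouped for each explicit node $v$ separately, ordered by $a$; the trees of type (b) are grouped for each heavy path $\pi$ separately, ordered by the string depth of $v$. In each case, for the sequence $\mathcal T_1,\dots,\mathcal T_r$ of substitution trees in question (if $r\geq 1$), one chooses a family of nonempty sets of consecutive trees that contains the whole sequence, in which any two sets are nested or disjoint, and such that $2|\mathcal G''|\le|\mathcal G|$ whenever $G''\subsetneq G'\subsetneq G$ are sets of the family, where the group tree $\mathcal G$ of $G$ is the merge of all trees in $G$. So the sizes of the group trees containing a given $\mathcal T_j$ halve at least in every second step. Group trees of type (a) have no main path; the main path of a group tree of type (b) is $\pi$. Then for every integer $k\ge 0$ there is a constant $C$, depending only on $k$, such that in every $k$-errata tree built from $x\ge2$ suffixes of any string $T$, for each terminal label $\ell\in R$, the number of terminals with label $\ell$ in all compact tries of levels $0,\dots,k$ together is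 at most $C\log_2^k x$. -/

import Mathlib

namespace Errata

/-- Strings over the letters of the text together with one special character `ψ = ⊥`. -/
abbrev Str (α : Type*) := List (WithBot α)

/-- The compact trie of a finite set of strings, each of which carries a label (a position of the
text). The nodes of a trie correspond one to one to the prefixes of its strings, so a node is
represented by its path label, and the trie is determined by its labelled strings.
Some tries have in addition a main path starting in the root, given by its string label. -/
@[ext] structure CompactTrie (α : Type*) where
  /-- the terminals: string and label -/
  terminals : Finset (Str α × ℕ)
  /-- the label of the main path, if there is one -/
  mainPath : Option (Str α)

namespace CompactTrie

variable {α : Type*} [LinearOrder α]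

/-- All (explicit and implicit) nodes. -/
def nodes (t : CompactTrie α) : Finset (Str α) :=
  insert [] ((t.terminals.biUnion fun p => p.1.inits.toFinset) ∪
    t.mainPath.elim ∅ fun m => m.inits.toFinset)

/-- The first characters on the edges that go down from `v`. -/
def out (t : CompactTrie α) (v : Str α) : Finset (WithBot α) :=
  (t.nodes.biUnion fun u => u.toFinset).filter fun c => v ++ [c] ∈ t.nodes

open Classical in
/-- The explicit nodes: the root, the terminals, the branching nodes, the end of the main path. -/
noncomputable def explicit (t : CompactTrie α) : Finset (Str α) :=
  t.nodes.filter fun v =>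
    v = [] ∨ (∃ i, (v, i) ∈ t.terminals) ∨ t.mainPath = some v ∨ 2 ≤ (t.out v).card

/-- The terminals in the subtree of `v`; their number is the size of that subtree. -/
def subtree (t : CompactTrie α) (v : Str α) : Finset (Str α × ℕ) :=
  t.terminals.filter fun p => v <+: p.1

/-- A heavy-light decomposition: `heavy v` is the first character on the edge from the explicit
node `v` to its heavy child. The main path is heavy; elsewhere the heavy child is a child whose
subtree has the maximum number of terminals among the children of `v`, with ties broken
arbitrarily. Only the values of `heavy` at explicit nodes that have a child matter. -/
structure IsHeavy (t : CompactTrie α) (heavy : Str α → WithBot α) : Prop where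
  mem_out : ∀ v ∈ t.explicit, (t.out v).Nonempty → heavy v ∈ t.out v
  main : ∀ v ∈ t.explicit, ∀ m, t.mainPath = some m → v <+: m → v ≠ m → v ++ [heavy v] <+: m
  max : ∀ v ∈ t.explicit, (∀ m, t.mainPath = some m → v <+: m → v = m) →
    ∀ c ∈ t.out v, (t.subtree (v ++ [c])).card ≤ (t.subtree (v ++ [heavy v])).card

open Classical in
/-- The light nodes: the root, and the explicit children `s` of explicit nodes `v` along an edge
whose first character `c` is not the heavy one. -/
noncomputable def light (t : CompactTrie α) (heavy : Str α → WithBot α) : Finset (Str α) :=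
  t.explicit.filter fun s =>
    s = [] ∨ ∃ v ∈ t.explicit, ∃ c ∈ t.out v, c ≠ heavy v ∧ v ++ [c] <+: s ∧
      ∀ w ∈ t.explicit, v ++ [c] <+: w → s <+: w

open Classical in
/-- The heavy paths, as pairs `(s, e)`: the path starts in the light node `s`, goes to the
heavy child in every explicit node, and ends in the leaf `e`. -/
noncomputable def heavyPaths (t : CompactTrie α) (heavy : Str α → WithBot α) :
    Finset (Str α × Str α) :=
  (t.light heavy ×ˢ t.explicit).filter fun q =>
    q.1 <+: q.2 ∧ t.out q.2 = ∅ ∧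
      ∀ u ∈ t.explicit, q.1 <+: u → u <+: q.2 → u ≠ q.2 → u ++ [heavy u] <+: q.2

/-- The first characters of the off-path subtrees at `v`. -/
def offChars (t : CompactTrie α) (heavy : Str α → WithBot α) (v : Str α) : Finset (WithBot α) :=
  (t.out v).erase (heavy v)

open Classical in
/-- The explicit nodes of the heavy path `(s, e)` that have an off-path subtree. -/
noncomputable def offNodes (t : CompactTrie α) (heavy : Str α → WithBot α) (s e : Str α) :
    Finset (Str α) :=
  t.explicit.filter fun v => s <+: v ∧ v <+: e ∧ (t.offChars heavy v).Nonempty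

/-- The terminals of the substitution tree of the off-path subtree of `v` with first
character `a`: this subtree is cut off at `v`, and its first character is replaced by `ψ`. -/
def substNode (t : CompactTrie α) (v : Str α) (a : WithBot α) : Finset (Str α × ℕ) :=
  (t.subtree (v ++ [a])).image fun p => (⊥ :: p.1.drop (v.length + 1), p.2)

/-- The terminals of the substitution tree of the node `v` of a heavy path starting in `s`: the
merge of the trees `substNode` over all off-path subtrees at `v`, with `ψ` replaced by the next
character of the heavy path, extended upwards by the path from `s` to `v`. -/
def substPath (t : CompactTrie α) (heavy : Str α → WithBot α) (s v : Str α) :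
    Finset (Str α × ℕ) :=
  (t.offChars heavy v).biUnion fun a =>
    (t.substNode v a).image fun p => (v.drop s.length ++ heavy v :: p.1.tail, p.2)

end CompactTrie

/-- `F` is an organization of substitution trees into group trees. The substitution trees are
indexed by `I`, are ordered by `key`, and have the terminals `sub j`; a group is a set `G` of
indices, and the group tree of `G` has the terminals `G.biUnion sub`. -/
structure IsGrouping {ι κ : Type*} [DecidableEq ι] [LinearOrder κ] {β : Type*} [DecidableEq β]
    (I : Finset ι) (key : ι → κ) (sub : ι → Finset β) (F : Finset (Finset ι)) : Prop where
  subset : ∀ G ∈ F, G ⊆ I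
  nonempty : ∀ G ∈ F, G.Nonempty
  /-- each group is contiguous in the order of merging -/
  contiguous : ∀ G ∈ F, ∀ a ∈ G, ∀ c ∈ G, ∀ b ∈ I, key a ≤ key b → key b ≤ key c → b ∈ G
  /-- all substitution trees together form the topmost group -/
  top : I.Nonempty → I ∈ F
  /-- the groups form a tree under inclusion -/
  laminar : ∀ G ∈ F, ∀ G' ∈ F, G ⊆ G' ∨ G' ⊆ G ∨ Disjoint G G'
  /-- the size of a group tree halves at least in every second step downwards -/
  halving : ∀ G ∈ F, ∀ G' ∈ F, ∀ G'' ∈ F, G'' ⊂ G' → G' ⊂ G →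
    2 * (G''.biUnion sub).card ≤ (G.biUnion sub).card

variable {α : Type*} [LinearOrder α]

/-- The group tree of substitution trees at one node; it has no main path. -/
def groupNode (t : CompactTrie α) (v : Str α) (G : Finset (WithBot α)) : CompactTrie α :=
  ⟨G.biUnion (t.substNode v), none⟩

/-- The group tree of substitution trees over the heavy path `(s, e)`, which becomes its main
path. -/
def groupPath (t : CompactTrie α) (heavy : Str α → WithBot α) (s e : Str α)
    (G : Finset (Str α)) : CompactTrie α :=
  ⟨G.biUnion (t.substPath heavy s), some (e.drop s.length)⟩

/-- `B` is a collection of compact tries formed from `t` in the next level: for some heavy-light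
decomposition, the group trees of some organization of the substitution trees of each explicit
node (`FN`), by first character, and of each heavy path (`FP`), by string depth. -/
def Forms (t : CompactTrie α) (B : Multiset (CompactTrie α)) : Prop :=
  ∃ (heavy : Str α → WithBot α) (FN : Str α → Finset (Finset (WithBot α)))
    (FP : Str α × Str α → Finset (Finset (Str α))),
    t.IsHeavy heavy ∧
    (∀ v ∈ t.explicit, IsGrouping (t.offChars heavy v) id (t.substNode v) (FN v)) ∧
    (∀ q ∈ t.heavyPaths heavy,
      IsGrouping (t.offNodes heavy q.1 q.2) List.length (t.substPath heavy q.1) (FP q)) ∧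
    B = (∑ v ∈ t.explicit, (FN v).val.map (groupNode t v)) +
      ∑ q ∈ t.heavyPaths heavy, (FP q).val.map (groupPath t heavy q.1 q.2)

/-- The compact trie of the suffixes of `T` that start at the positions in `R`. -/
def baseTrie (T : List α) (R : Finset ℕ) : CompactTrie α :=
  ⟨R.image fun i => ((T.drop i).map (fun c => (c : WithBot α)), i), none⟩

/-- `level 0, …, level k` are the collections of compact tries at the levels `0, …, k` of a
`k`-errata tree for the suffixes of `T` that start at the positions in `R`. Tries formed from
different tries, nodes, heavy paths or groups are different members of the collection. -/
structure IsErrataTree (k : ℕ) (T : List α) (R : Finset ℕ)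
    (level : ℕ → Multiset (CompactTrie α)) : Prop where
  zero : level 0 = {baseTrie T R}
  succ : ∀ i < k, ∃ P : Multiset (CompactTrie α × Multiset (CompactTrie α)),
    P.map Prod.fst = level i ∧ (∀ p ∈ P, Forms p.1 p.2) ∧ (P.map Prod.snd).sum = level (i + 1)

/-- The number of terminals with label `l` in `t`. -/
def CompactTrie.occ (t : CompactTrie α) (l : ℕ) : ℕ :=
  (t.terminals.filter fun p => p.2 = l).card

/-- The number of terminals with label `l` in all compact tries of the levels `0, …, k`. -/
def totalOcc (k : ℕ) (level : ℕ → Multiset (CompactTrie α)) (l : ℕ) : ℕ :=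
  ∑ i ∈ Finset.range (k + 1), ((level i).map fun t => t.occ l).sum

end Errata

/-! Fix a trie with N terminals, and one terminal p of it. Whenever p leaves a node v by a non-heavy
edge, it is copied into the groups that contain its substitution tree. Laminarity makes these groups
a chain. If their sizes lie between m and M, halving in every second step allows at most 2 log(M/m)
+ 2 of them (`two_pow_card_chain_le`). Here m is the size of the subtree below the edge, and M is
the size of the subtree of v for type (a), or of the start of the heavy path for type (b).

Where the main path does not continue below v, the heavy child is a largest one, so 2m ≤ M and the
bound becomes 4 log(M/m). The main path itself is left by p at most once, so a single extra 2
survives. The stretches of p that carry these quotients are disjoint, so the logarithms telescope to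
4 log N + 2 for each type (`sum_le_log`).

One step therefore multiplies the occurrences of a label by at most 8 log N + 4
(`Forms.sum_occ_le`). Tries never outgrow the trie they are formed from, so N ≤ x throughout, and
induction bounds level i by (12 log x)^i. -/

namespace Errata

/-! ### Prefixes and divergence of strings -/

section Lists

variable {β : Type*}

theorem append_singleton_prefix_of_lt {v w p : List β} {a : β} (hv : v ++ [a] <+: p)
    (hw : w <+: p) (h : v.length < w.length) : v ++ [a] <+: w :=
  List.prefix_of_prefix_length_le hv hw (by simpa using h)

theorem append_singleton_prefix_inj {v p : List β} {a b : β} (ha : v ++ [a] <+: p)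
    (hb : v ++ [b] <+: p) : a = b := by
  have := (List.prefix_of_prefix_length_le ha hb (by simp)).eq_of_length (by simp)
  simpa using this

theorem prefix_of_append_singleton_prefix {v p : List β} {a : β} (h : v ++ [a] <+: p) : v <+: p :=
  (List.prefix_append v [a]).trans h

theorem prefix_or_prefix_or_diverge (p q : List β) :
    p <+: q ∨ q <+: p ∨ ∃ u x y, x ≠ y ∧ u ++ [x] <+: p ∧ u ++ [y] <+: q := by
  induction p generalizing q with
  | nil => simp
  | cons a p ih =>
    cases q with
    | nil => simp
    | cons b q =>
      by_cases hab : a = b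
      · subst hab
        rcases ih q with h | h | ⟨u, x, y, hxy, hx, hy⟩
        · simp [h]
        · simp [h]
        · exact Or.inr (Or.inr ⟨a :: u, x, y, hxy, by simpa using hx, by simpa using hy⟩)
      · exact Or.inr (Or.inr ⟨[], a, b, hab, by simp, by simp⟩)

/-- The node at which two strings diverge is unique. -/
theorem diverge_unique {v w p m : List β} {a b a' b' : β} (hp : v ++ [a] <+: p)
    (hm : v ++ [b] <+: m) (hab : a ≠ b) (hp' : w ++ [a'] <+: p) (hm' : w ++ [b'] <+: m)
    (hab' : a' ≠ b') : v = w := by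
  have hv := prefix_of_append_singleton_prefix hp
  have hw := prefix_of_append_singleton_prefix hp'
  rcases lt_trichotomy v.length w.length with h | h | h
  · exact absurd (append_singleton_prefix_inj ((append_singleton_prefix_of_lt hp hw h).trans
      (prefix_of_append_singleton_prefix hm')) hm) hab
  · exact (List.prefix_of_prefix_length_le hv hw h.le).eq_of_length h
  · exact absurd (append_singleton_prefix_inj ((append_singleton_prefix_of_lt hp' hv h).trans
      (prefix_of_append_singleton_prefix hm)) hm') hab'

end Lists

/-! ### Telescoping, and chains of groups -/

section Chains

/-- Telescoping over pairwise disjoint intervals. -/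
theorem sum_sub_le_of_disjoint {ι : Type*} (Q : Finset ι) (h l : ι → ℕ) (N : ℕ) (φ : ℕ → ℝ)
    (hφ : Antitone φ) (hhl : ∀ i ∈ Q, h i ≤ l i) (hN : ∀ i ∈ Q, l i ≤ N)
    (hdisj : ∀ i ∈ Q, ∀ j ∈ Q, i ≠ j → l i ≤ h j ∨ l j ≤ h i) :
    ∑ i ∈ Q, (φ (h i) - φ (l i)) ≤ φ 0 - φ N := by
  classical
  have hpd : (Q : Set ι).PairwiseDisjoint fun i => Finset.Ico (h i) (l i) := by
    intro i hi j hj hij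
    rw [Function.onFun, Finset.disjoint_left]
    intro n hn hn'
    rw [Finset.mem_Ico] at hn hn'
    rcases hdisj i hi j hj hij with h | h <;> omega
  calc ∑ i ∈ Q, (φ (h i) - φ (l i))
      = ∑ i ∈ Q, ∑ n ∈ Finset.Ico (h i) (l i), (φ n - φ (n + 1)) := by
        refine Finset.sum_congr rfl fun i hi => ?_
        have := Finset.sum_Ico_sub φ (hhl i hi)
        rw [← neg_inj, ← Finset.sum_neg_distrib]
        simpa using this.symm
    _ = ∑ n ∈ Q.biUnion fun i => Finset.Ico (h i) (l i), (φ n - φ (n + 1)) :=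
        (Finset.sum_biUnion hpd).symm
    _ ≤ ∑ n ∈ Finset.range N, (φ n - φ (n + 1)) := by
        refine Finset.sum_le_sum_of_subset_of_nonneg ?_ fun n _ _ => ?_
        · intro n hn
          obtain ⟨i, hi, hn⟩ := Finset.mem_biUnion.1 hn
          rw [Finset.mem_Ico] at hn
          exact Finset.mem_range.2 (hn.2.trans_le (hN i hi))
        · exact sub_nonneg.2 (hφ n.le_succ)
    _ = φ 0 - φ N := Finset.sum_range_sub' φ N

/-- A chain of sets of size between `m` and `M`, in which sizes halve in every second step, has
about `2 * log (M / m)` members. -/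
theorem two_pow_card_chain_le {ι : Type*} (size : Finset ι → ℕ) {m : ℕ} :
    ∀ (n : ℕ) (C : Finset (Finset ι)) (M : ℕ), C.card = n → m ≤ M →
      (∀ G ∈ C, m ≤ size G ∧ size G ≤ M) →
      (∀ G ∈ C, ∀ G' ∈ C, G ⊆ G' ∨ G' ⊆ G) →
      (∀ G ∈ C, ∀ G' ∈ C, ∀ G'' ∈ C, G'' ⊂ G' → G' ⊂ G → 2 * size G'' ≤ size G) →
      2 ^ n * m ^ 2 ≤ 4 * M ^ 2 := by
  classical
  have top : ∀ C : Finset (Finset ι), C.Nonempty → (∀ G ∈ C, ∀ G' ∈ C, G ⊆ G' ∨ G' ⊆ G) →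
      ∃ G ∈ C, ∀ G' ∈ C.erase G, G' ⊂ G := by
    intro C hC hch
    obtain ⟨G, hG, hmax⟩ := Finset.exists_max_image C Finset.card hC
    refine ⟨G, hG, fun G' hG' => ?_⟩
    rw [Finset.mem_erase] at hG'
    rcases hch G hG G' hG'.2 with h | h
    · exact absurd (Finset.eq_of_subset_of_card_le h (hmax G' hG'.2)).symm hG'.1
    · exact h.ssubset_of_ne hG'.1
  intro n
  induction n using Nat.strong_induction_on with
  | _ n ih =>
    intro C M hcard hmM hsize hch hhalf
    have hsq : m ^ 2 ≤ M ^ 2 := Nat.pow_le_pow_left hmM 2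
    -- Halving says nothing about two sets or fewer; the factor 4 = 2 ^ 2 pays for them.
    by_cases hn : n ≤ 2
    · have : 2 ^ n ≤ 2 ^ 2 := Nat.pow_le_pow_right (by norm_num) hn
      exact Nat.mul_le_mul this hsq
    push Not at hn
    -- Removing the two topmost sets leaves only sizes at most M / 2. The factor 4 lost from 2 ^ n
    -- is regained from the square of M.
    obtain ⟨G, hG, hGt⟩ := top C (Finset.card_pos.1 (by omega)) hch
    have hc1 : (C.erase G).card = n - 1 := by rw [Finset.card_erase_of_mem hG, hcard]
    obtain ⟨G', hG', hGt'⟩ := top (C.erase G) (Finset.card_pos.1 (by omega)) fun A hA B hB =>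
      hch A (Finset.mem_of_mem_erase hA) B (Finset.mem_of_mem_erase hB)
    have hc2 : ((C.erase G).erase G').card = n - 2 := by
      rw [Finset.card_erase_of_mem hG', hc1]; omega
    have hsub : ∀ A ∈ (C.erase G).erase G', A ∈ C := fun A hA =>
      Finset.mem_of_mem_erase (Finset.mem_of_mem_erase hA)
    have hsz : ∀ A ∈ (C.erase G).erase G', m ≤ size A ∧ size A ≤ M / 2 := fun A hA => by
      have := hhalf G hG G' (Finset.mem_of_mem_erase hG') A (hsub A hA) (hGt' A hA) (hGt G' hG')
      have h1 := hsize A (hsub A hA)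
      have h2 := hsize G hG
      omega
    obtain ⟨A, hA⟩ : ((C.erase G).erase G').Nonempty := Finset.card_pos.1 (by omega)
    have key := ih (n - 2) (by omega) _ (M / 2) hc2 ((hsz A hA).1.trans (hsz A hA).2) hsz
      (fun A hA B hB => hch A (hsub A hA) B (hsub B hB))
      (fun A hA B hB D hD => hhalf A (hsub A hA) B (hsub B hB) D (hsub D hD))
    have h4 : 4 * (M / 2) ^ 2 ≤ M ^ 2 := by
      have : 2 * (M / 2) ≤ M := Nat.mul_div_le M 2
      calc 4 * (M / 2) ^ 2 = (2 * (M / 2)) ^ 2 := by ring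
        _ ≤ M ^ 2 := Nat.pow_le_pow_left this 2
    have hp : 2 ^ n = 4 * 2 ^ (n - 2) := by
      conv_lhs => rw [show n = 2 + (n - 2) by omega, pow_add]
      norm_num
    rw [hp, mul_assoc]
    exact Nat.mul_le_mul_left 4 (key.trans h4)

variable {ι κ : Type*} [DecidableEq ι] [LinearOrder κ] {β : Type*} [DecidableEq β]
  {I : Finset ι} {key : ι → κ} {sub : ι → Finset β} {F : Finset (Finset ι)}

/-- Groups sharing the index `j` are not disjoint, so laminarity makes them a chain. Each of their
group trees contains `sub j` and is contained in the merge over `I`. -/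
theorem IsGrouping.two_pow_card_le (hF : IsGrouping I key sub F) {j : ι} {m M : ℕ}
    (hj : j ∈ I) (hm : m ≤ (sub j).card) (hM : (I.biUnion sub).card ≤ M) :
    2 ^ (F.filter (j ∈ ·)).card * m ^ 2 ≤ 4 * M ^ 2 := by
  have hle : ∀ G : Finset ι, j ∈ G → m ≤ (G.biUnion sub).card := fun G hG =>
    hm.trans (Finset.card_le_card (Finset.subset_biUnion_of_mem sub hG))
  refine two_pow_card_chain_le (fun G => (G.biUnion sub).card) _ _ M rfl
    ((hle I hj).trans hM) ?_ ?_ ?_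
  · intro G hG
    rw [Finset.mem_filter] at hG
    exact ⟨hle G hG.2, (Finset.card_le_card
      (Finset.biUnion_subset_biUnion_of_subset_left sub (hF.subset G hG.1))).trans hM⟩
  · intro G hG G' hG'
    rw [Finset.mem_filter] at hG hG'
    rcases hF.laminar G hG.1 G' hG'.1 with h | h | h
    · exact Or.inl h
    · exact Or.inr h
    · exact absurd hG'.2 (Finset.disjoint_left.1 h hG.2)
  · intro G hG G' hG' G'' hG''
    exact hF.halving G (Finset.mem_filter.1 hG).1 G' (Finset.mem_filter.1 hG').1 G''
      (Finset.mem_filter.1 hG'').1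

/-- Taking logarithms gives the bound 2 log(M/m) + 2. If 2m ≤ M, the summand 2 is at most 2
log(M/m). `E` marks the exceptional case, later that of a node on the main path, where the summand
has to stay. -/
theorem IsGrouping.card_le_log (hF : IsGrouping I key sub F) {j : ι} {m M : ℕ} (hj : j ∈ I)
    (hm : m ≤ (sub j).card) (hM : (I.biUnion sub).card ≤ M) (hm0 : 0 < m) (hmM : m ≤ M)
    {E : Prop} [Decidable E] (hE : ¬ E → 2 * m ≤ M) :
    ((F.filter (j ∈ ·)).card : ℝ) ≤
      4 * (Real.logb 2 M - Real.logb 2 m) + if E then 2 else 0 := by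
  have h := hF.two_pow_card_le hj hm hM
  set g := (F.filter (j ∈ ·)).card
  have hm' : (0 : ℝ) < m := by exact_mod_cast hm0
  have hM' : (0 : ℝ) < M := by exact_mod_cast hm0.trans_le hmM
  have h2 : (2 : ℝ) ^ g * (m : ℝ) ^ 2 ≤ 2 ^ 2 * (M : ℝ) ^ 2 := by
    norm_num; exact_mod_cast h
  have h3 := Real.logb_le_logb_of_le (b := 2) (by norm_num) (by positivity) h2
  rw [Real.logb_mul (by positivity) (by positivity), Real.logb_mul (by positivity) (by positivity),
    Real.logb_pow, Real.logb_pow, Real.logb_pow, Real.logb_pow, Real.logb_self_eq_one (by norm_num)]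
    at h3
  push_cast at h3
  split_ifs with hEE
  · have := Real.logb_le_logb_of_le (b := 2) (by norm_num) hm' (Nat.cast_le.2 hmM)
    linarith
  · have h5 : (2 : ℝ) * m ≤ M := by exact_mod_cast hE hEE
    have := Real.logb_le_logb_of_le (b := 2) (by norm_num) (by positivity) h5
    rw [Real.logb_mul (by norm_num) hm'.ne', Real.logb_self_eq_one (by norm_num)] at this
    linarith

/-- Double counting of pairs of a group and a member. Only an inequality holds, because a merge may
identify equal terminals. -/
theorem IsGrouping.sum_card_filter_le (hF : IsGrouping I key sub F) (P : β → Prop)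
    [DecidablePred P] :
    ∑ G ∈ F, ((G.biUnion sub).filter P).card ≤
      ∑ j ∈ I, (F.filter (j ∈ ·)).card * ((sub j).filter P).card := by
  calc ∑ G ∈ F, ((G.biUnion sub).filter P).card
      ≤ ∑ G ∈ F, ∑ j ∈ G, ((sub j).filter P).card :=
        Finset.sum_le_sum fun G _ => by
          rw [Finset.filter_biUnion]; exact Finset.card_biUnion_le
    _ = ∑ G ∈ F, ∑ j ∈ I, if j ∈ G then ((sub j).filter P).card else 0 :=
        Finset.sum_congr rfl fun G hG => by
          rw [← Finset.sum_filter, Finset.filter_mem_eq_inter,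
            Finset.inter_eq_right.2 (hF.subset G hG)]
    _ = _ := by
        rw [Finset.sum_comm]
        refine Finset.sum_congr rfl fun j _ => ?_
        rw [← Finset.sum_filter, Finset.sum_const, smul_eq_mul]

end Chains

/-! ### Nodes and heavy paths of a trie -/

namespace CompactTrie

variable {α : Type*} [LinearOrder α] {t : CompactTrie α} {heavy : Str α → WithBot α}

theorem mem_subtree {v : Str α} {p : Str α × ℕ} :
    p ∈ t.subtree v ↔ p ∈ t.terminals ∧ v <+: p.1 := by
  simp [subtree]

theorem mem_offChars {v : Str α} {a : WithBot α} :
    a ∈ t.offChars heavy v ↔ a ≠ heavy v ∧ a ∈ t.out v := by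
  simp [offChars]

theorem mem_heavyPaths {s e : Str α} :
    (s, e) ∈ t.heavyPaths heavy ↔ (s ∈ t.light heavy ∧ e ∈ t.explicit) ∧ s <+: e ∧
      t.out e = ∅ ∧ ∀ u ∈ t.explicit, s <+: u → u <+: e → u ≠ e → u ++ [heavy u] <+: e := by
  simp [heavyPaths]

theorem mem_offNodes {s e v : Str α} :
    v ∈ t.offNodes heavy s e ↔
      v ∈ t.explicit ∧ s <+: v ∧ v <+: e ∧ (t.offChars heavy v).Nonempty := by
  simp [offNodes]

theorem mem_nodes_of_prefix {u v : Str α} (hv : v ∈ t.nodes) (huv : u <+: v) : u ∈ t.nodes := by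
  have hop : ∀ o : Option (Str α), (v ∈ o.elim ∅ fun m => m.inits.toFinset) →
      u ∈ o.elim ∅ fun m => m.inits.toFinset := by
    intro o ho
    cases o with
    | none => simp at ho
    | some m =>
      simp only [Option.elim_some, List.mem_toFinset, List.mem_inits] at ho ⊢
      exact huv.trans ho
  simp only [nodes, Finset.mem_insert, Finset.mem_union, Finset.mem_biUnion, List.mem_toFinset,
    List.mem_inits] at hv ⊢
  rcases hv with rfl | ⟨p, hp, h⟩ | h
  · exact Or.inl (List.prefix_nil.1 huv)
  · exact Or.inr (Or.inl ⟨p, hp, huv.trans h⟩)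
  · exact Or.inr (Or.inr (hop _ h))

theorem mem_out {v : Str α} {c : WithBot α} : c ∈ t.out v ↔ v ++ [c] ∈ t.nodes := by
  simp only [out, Finset.mem_filter, Finset.mem_biUnion, List.mem_toFinset, and_iff_right_iff_imp]
  exact fun h => ⟨_, h, by simp⟩

theorem mem_nodes_of_mem_explicit {v : Str α} (hv : v ∈ t.explicit) : v ∈ t.nodes := by
  simp only [explicit, Finset.mem_filter] at hv
  exact hv.1

theorem mem_explicit_of_out {v : Str α} {a b : WithBot α} (ha : a ∈ t.out v) (hb : b ∈ t.out v)
    (hab : a ≠ b) : v ∈ t.explicit := by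
  simp only [explicit, Finset.mem_filter]
  exact ⟨mem_nodes_of_prefix (mem_out.1 ha) (List.prefix_append _ _),
    Or.inr (Or.inr (Or.inr (Finset.one_lt_card.2 ⟨a, ha, b, hb, hab⟩)))⟩

theorem subtree_anti {u v : Str α} (h : u <+: v) : t.subtree v ⊆ t.subtree u := fun p hp => by
  rw [mem_subtree] at hp ⊢
  exact ⟨hp.1, h.trans hp.2⟩

/-- A node with an off-path subtree has a child, so it is not the leaf `e`, and the path continues
through its heavy edge. -/
theorem off_spec {s e v : Str α} (hq : (s, e) ∈ t.heavyPaths heavy)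
    (hv : v ∈ t.offNodes heavy s e) : s <+: v ∧ v ++ [heavy v] <+: e := by
  rw [mem_heavyPaths] at hq
  rw [mem_offNodes] at hv
  obtain ⟨hve, hsv, hvE, a, ha⟩ := hv
  refine ⟨hsv, hq.2.2.2 v hve hsv hvE ?_⟩
  rintro rfl
  have := (mem_offChars.1 ha).2
  rw [hq.2.2.1] at this
  simp at this

/-- A heavy path is determined by its start. -/
theorem heavyPaths_end_unique {s e e' : Str α} (hq : (s, e) ∈ t.heavyPaths heavy)
    (hq' : (s, e') ∈ t.heavyPaths heavy) : e = e' := by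
  rw [mem_heavyPaths] at hq hq'
  have leaf : ∀ {e e' : Str α}, e' ∈ t.explicit → t.out e = ∅ → e <+: e' → e = e' := by
    rintro e e' he' ho ⟨r, rfl⟩
    cases r with
    | nil => simp
    | cons c r =>
      have : c ∈ t.out e := mem_out.2 (mem_nodes_of_prefix (mem_nodes_of_mem_explicit he')
        ⟨r, by simp⟩)
      simp [ho] at this
  rcases prefix_or_prefix_or_diverge e e' with h | h | ⟨u, x, y, hxy, hx, hy⟩
  · exact leaf hq'.1.2 hq.2.2.1 h
  · exact (leaf hq.1.2 hq'.2.2.1 h).symm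
  · exfalso
    have hue : u ∈ t.explicit := mem_explicit_of_out
      (mem_out.2 (mem_nodes_of_prefix (mem_nodes_of_mem_explicit hq.1.2) hx))
      (mem_out.2 (mem_nodes_of_prefix (mem_nodes_of_mem_explicit hq'.1.2) hy)) hxy
    -- Both ends extend `s`, so they cannot diverge strictly above it.
    have hsu : s <+: u := by
      by_contra hns
      have hlt : u.length < s.length := by
        by_contra hle
        exact hns (List.prefix_of_prefix_length_le hq.2.1
          (prefix_of_append_singleton_prefix hx) (not_lt.1 hle))
      exact hxy (append_singleton_prefix_inj
        ((append_singleton_prefix_of_lt hx hq.2.1 hlt).trans hq'.2.1) hy)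
    have ne : ∀ {e : Str α} {x : WithBot α}, u ++ [x] <+: e → u ≠ e := by
      rintro e x h rfl
      simpa using h.length_le
    have h1 := hq.2.2.2 u hue hsu (prefix_of_append_singleton_prefix hx) (ne hx)
    have h2 := hq'.2.2.2 u hue hsu (prefix_of_append_singleton_prefix hy) (ne hy)
    exact hxy ((append_singleton_prefix_inj hx h1).trans (append_singleton_prefix_inj h2 hy))

/-- A heavy path contains no light node besides its start. -/
theorem start_eq_of_light {s e s' : Str α} (hq : (s, e) ∈ t.heavyPaths heavy)
    (hs' : s' ∈ t.light heavy) (hss' : s <+: s') (hs'e : s' <+: e) : s = s' := by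
  rw [mem_heavyPaths] at hq
  have hse : s ∈ t.explicit := by
    have := hq.1.1
    simp only [light, Finset.mem_filter] at this
    exact this.1
  simp only [light, Finset.mem_filter] at hs'
  obtain ⟨-, rfl | ⟨w, hw, c, hc, hch, hcs, hmin⟩⟩ := hs'
  · exact List.prefix_nil.1 hss'
  · have hws := prefix_of_append_singleton_prefix hcs
    -- Here `w` is the parent of `s'`. If it lies above `s`, then `s` is below the same edge, and
    -- `s'` as the first explicit node there is a prefix of `s`. Otherwise `w` is on the path, whose
    -- edge out of `w` is heavy, unlike `c`.
    by_cases hlt : w.length < s.length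
    · have := hmin s hse (append_singleton_prefix_of_lt hcs hss' hlt)
      exact hss'.eq_of_length (le_antisymm hss'.length_le this.length_le)
    · have hsw := List.prefix_of_prefix_length_le hss' hws (not_lt.1 hlt)
      have hne : w ≠ e := by
        rintro rfl
        simpa using (hcs.trans hs'e).length_le
      exact absurd (append_singleton_prefix_inj (hcs.trans hs'e)
        (hq.2.2.2 w hw hsw (hws.trans hs'e) hne)) hch

/-- The stretches of the different heavy paths on the way to a terminal are disjoint. -/
theorem heavyPaths_stretch_disjoint {s e v s' e' v' p : Str α} {a a' : WithBot α}
    (hq : (s, e) ∈ t.heavyPaths heavy) (hv : v ∈ t.offNodes heavy s e)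
    (ha : a ∈ t.offChars heavy v) (hp : v ++ [a] <+: p)
    (hq' : (s', e') ∈ t.heavyPaths heavy) (hv' : v' ∈ t.offNodes heavy s' e')
    (ha' : a' ∈ t.offChars heavy v') (hp' : v' ++ [a'] <+: p)
    (hne : (s, e, v) ≠ (s', e', v')) : v.length + 1 ≤ s'.length ∨ v'.length + 1 ≤ s.length := by
  obtain ⟨hsv, hve⟩ := off_spec hq hv
  obtain ⟨hsv', hve'⟩ := off_spec hq' hv'
  have hvp := prefix_of_append_singleton_prefix hp
  have hvp' := prefix_of_append_singleton_prefix hp'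
  have hl := (mem_heavyPaths.1 hq).1.1
  have hl' := (mem_heavyPaths.1 hq').1.1
  by_contra hcon
  push Not at hcon
  -- If the stretches overlap, the deeper of the two starts is a light node on the other path, hence
  -- is its start.
  have hss : s = s' := by
    rcases le_total s.length s'.length with h | h
    · have h1 : s' <+: v :=
        List.prefix_of_prefix_length_le (hsv'.trans hvp') hvp (by omega)
      exact start_eq_of_light hq hl'
        (List.prefix_of_prefix_length_le (hsv.trans hvp) (hsv'.trans hvp') h)
        (h1.trans (prefix_of_append_singleton_prefix hve))
    · have h1 : s <+: v' :=
        List.prefix_of_prefix_length_le (hsv.trans hvp) hvp' (by omega)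
      exact (start_eq_of_light hq' hl
        (List.prefix_of_prefix_length_le (hsv'.trans hvp') (hsv.trans hvp) h)
        (h1.trans (prefix_of_append_singleton_prefix hve'))).symm
  subst hss
  have hee := heavyPaths_end_unique hq hq'
  subst hee
  -- On a common heavy path, `p` diverges from `e` at both nodes.
  have := diverge_unique hp hve (mem_offChars.1 ha).1 hp' hve' (mem_offChars.1 ha').1
  subst this
  exact hne rfl

/-! ### Sizes of subtrees and substitution trees -/

section Sizes

/-- A common terminal would diverge from `m` at `v` and at `w`, which forces the two nodes and then
the two characters to agree. -/
theorem disjoint_subtree {v w m : Str α} {a b c d : WithBot α} (hv : v ++ [c] <+: m)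
    (hac : a ≠ c) (hw : w ++ [d] <+: m) (hbd : b ≠ d) (hne : (v, a) ≠ (w, b)) :
    Disjoint (t.subtree (v ++ [a])) (t.subtree (w ++ [b])) := by
  rw [Finset.disjoint_left]
  intro p hp hp'
  rw [mem_subtree] at hp hp'
  have := diverge_unique hp.2 hv hac hp'.2 hw hbd
  subst this
  exact hne (by rw [append_singleton_prefix_inj hp.2 hp'.2])

theorem disjoint_subtree_children {v : Str α} {a b : WithBot α} (hab : a ≠ b) :
    Disjoint (t.subtree (v ++ [a])) (t.subtree (v ++ [b])) := by
  rw [Finset.disjoint_left]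
  intro p hp hp'
  rw [mem_subtree] at hp hp'
  exact hab (append_singleton_prefix_inj hp.2 hp'.2)

/-- The deleted part `v ++ [a]` is common to all strings of the subtree, so the substitution is
injective there. -/
theorem card_substNode (v : Str α) (a : WithBot α) :
    (t.substNode v a).card = (t.subtree (v ++ [a])).card := by
  refine Finset.card_image_of_injOn ?_
  rintro ⟨p, i⟩ hp ⟨q, j⟩ hq h
  obtain ⟨r, rfl⟩ := (mem_subtree.1 hp).2
  obtain ⟨r', rfl⟩ := (mem_subtree.1 hq).2
  have hd : ∀ r, ((v ++ [a]) ++ r).drop (v.length + 1) = r := fun r =>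
    List.drop_left' (by simp)
  simp only [hd, Prod.mk.injEq, List.cons.injEq, true_and] at h
  rw [h.1, h.2]

theorem card_biUnion_substNode_le (v : Str α) (S : Finset (WithBot α)) :
    (S.biUnion (t.substNode v)).card ≤ (t.subtree v).card := by
  calc (S.biUnion (t.substNode v)).card ≤ ∑ a ∈ S, (t.substNode v a).card :=
        Finset.card_biUnion_le
    _ = (S.biUnion fun a => t.subtree (v ++ [a])).card := by
        rw [Finset.card_biUnion fun a _ b _ hab => disjoint_subtree_children hab]
        exact Finset.sum_congr rfl fun a _ => card_substNode v a
    _ ≤ _ := Finset.card_le_card (Finset.biUnion_subset.2 fun a _ =>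
        subtree_anti (List.prefix_append _ _))

/-- Rewriting is injective on the contribution of a single `a`. Different characters may produce
equal terminals, so one off-path subtree serves as the lower bound. -/
theorem card_subtree_le_card_substPath (s : Str α) {v : Str α} {a : WithBot α}
    (ha : a ∈ t.offChars heavy v) :
    (t.subtree (v ++ [a])).card ≤ (t.substPath heavy s v).card := by
  have hinj : Set.InjOn (fun p : Str α × ℕ => (v.drop s.length ++ heavy v :: p.1.tail, p.2))
      (t.substNode v a) := by
    intro p hp q hq h
    obtain ⟨p', -, rfl⟩ := Finset.mem_image.1 (Finset.mem_coe.1 hp)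
    obtain ⟨q', -, rfl⟩ := Finset.mem_image.1 (Finset.mem_coe.1 hq)
    simpa using h
  rw [← card_substNode, ← Finset.card_image_of_injOn hinj]
  refine Finset.card_le_card fun x hx => ?_
  exact Finset.mem_biUnion.2 ⟨a, ha, hx⟩

/-- The off-path subtrees hanging from one heavy path are pairwise disjoint and all lie below its
start. -/
theorem card_biUnion_substPath_le {s e : Str α} (hq : (s, e) ∈ t.heavyPaths heavy)
    {S : Finset (Str α)} (hS : S ⊆ t.offNodes heavy s e) :
    (S.biUnion (t.substPath heavy s)).card ≤ (t.subtree s).card := by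
  calc (S.biUnion (t.substPath heavy s)).card
      ≤ ∑ v ∈ S, (t.substPath heavy s v).card := Finset.card_biUnion_le
    _ ≤ ∑ v ∈ S, ∑ a ∈ t.offChars heavy v, (t.subtree (v ++ [a])).card :=
        Finset.sum_le_sum fun v _ => Finset.card_biUnion_le.trans
          (Finset.sum_le_sum fun a _ => Finset.card_image_le.trans (card_substNode v a).le)
    _ = ∑ x ∈ S.sigma fun v => t.offChars heavy v, (t.subtree (x.1 ++ [x.2])).card :=
        (Finset.sum_sigma S _ fun x => (t.subtree (x.1 ++ [x.2])).card).symm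
    _ = ((S.sigma fun v => t.offChars heavy v).biUnion fun x => t.subtree (x.1 ++ [x.2])).card := by
        refine (Finset.card_biUnion ?_).symm
        rintro ⟨v, a⟩ hv ⟨w, b⟩ hw hne
        rw [Finset.mem_coe, Finset.mem_sigma] at hv hw
        refine disjoint_subtree (off_spec hq (hS hv.1)).2 (mem_offChars.1 hv.2).1
          (off_spec hq (hS hw.1)).2 (mem_offChars.1 hw.2).1 fun h => hne ?_
        rw [Prod.mk.injEq] at h
        obtain ⟨rfl, rfl⟩ := h
        rfl
    _ ≤ _ := by
        refine Finset.card_le_card (Finset.biUnion_subset.2 fun x hx => subtree_anti ?_)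
        exact (off_spec hq (hS (Finset.mem_sigma.1 hx).1)).1.trans (List.prefix_append _ _)

/-- The node `v` lies on the main path, but is not its end. -/
def InnerMain (t : CompactTrie α) (v : Str α) : Prop :=
  ∃ m, t.mainPath = some m ∧ v <+: m ∧ v ≠ m

/-- The heavy sibling is disjoint from this child's subtree and at least as large. -/
theorem IsHeavy.two_mul_card_le (hh : t.IsHeavy heavy) {v : Str α} (hv : v ∈ t.explicit)
    {a : WithBot α} (ha : a ∈ t.offChars heavy v) (hm : ¬ t.InnerMain v) :
    2 * (t.subtree (v ++ [a])).card ≤ (t.subtree v).card := by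
  rw [mem_offChars] at ha
  have hmax := hh.max v hv (fun m h1 h2 => by_contra fun h3 => hm ⟨m, h1, h2, h3⟩) a ha.2
  have hun := Finset.card_le_card (Finset.union_subset
    (subtree_anti (t := t) (List.prefix_append v [a]))
    (subtree_anti (t := t) (List.prefix_append v [heavy v])))
  rw [Finset.card_union_of_disjoint (disjoint_subtree_children ha.1)] at hun
  omega

/-- A terminal leaves the main path at most once. -/
theorem IsHeavy.innerMain_unique (hh : t.IsHeavy heavy) {p v w : Str α} {a b : WithBot α}
    (hv : v ∈ t.explicit) (ha : a ∈ t.offChars heavy v) (hp : v ++ [a] <+: p)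
    (hm : t.InnerMain v) (hw : w ∈ t.explicit) (hb : b ∈ t.offChars heavy w)
    (hp' : w ++ [b] <+: p) (hm' : t.InnerMain w) : v = w := by
  obtain ⟨m, h1, h2, h3⟩ := hm
  obtain ⟨m', h1', h2', h3'⟩ := hm'
  obtain rfl : m = m' := by simpa [h1] using h1'
  exact diverge_unique hp (hh.main v hv m h1 h2 h3) (mem_offChars.1 ha).1 hp'
    (hh.main w hw m h1 h2' h3') (mem_offChars.1 hb).1

end Sizes

/-! ### Logarithmic sizes along a terminal -/

section Logs

/-- The logarithm of the size of the subtree of a prefix. -/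
noncomputable def logSize (t : CompactTrie α) (p : Str α) (n : ℕ) : ℝ :=
  Real.logb 2 (t.subtree (p.take n)).card

theorem card_subtree_pos {p : Str α × ℕ} (hp : p ∈ t.terminals) {v : Str α} (hv : v <+: p.1) :
    0 < (t.subtree v).card :=
  Finset.card_pos.2 ⟨p, mem_subtree.2 ⟨hp, hv⟩⟩

theorem logSize_antitone {p : Str α × ℕ} (hp : p ∈ t.terminals) : Antitone (t.logSize p.1) := by
  intro m n h
  refine Real.logb_le_logb_of_le (by norm_num)
    (Nat.cast_pos.2 (card_subtree_pos hp (List.take_prefix _ _))) (Nat.cast_le.2 ?_)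
  exact Finset.card_le_card (subtree_anti (List.take_prefix_take_left h))

theorem logSize_length {p v : Str α} (hv : v <+: p) :
    t.logSize p v.length = Real.logb 2 (t.subtree v).card := by
  rw [logSize, ← List.prefix_iff_eq_take.1 hv]

/-- Bounding a sum over the places where a terminal leaves heavy paths. -/
theorem sum_le_log {ι : Type*} {p : Str α × ℕ} (hp : p ∈ t.terminals) (Q : Finset ι)
    (h l : ι → ℕ) (g : ι → ℕ) (E : ι → Prop) [DecidablePred E] (hhl : ∀ i ∈ Q, h i ≤ l i)
    (hN : ∀ i ∈ Q, l i ≤ p.1.length)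
    (hdisj : ∀ i ∈ Q, ∀ j ∈ Q, i ≠ j → l i ≤ h j ∨ l j ≤ h i)
    (hE : ∀ i ∈ Q, ∀ j ∈ Q, E i → E j → i = j)
    (hg : ∀ i ∈ Q, (g i : ℝ) ≤
      4 * (t.logSize p.1 (h i) - t.logSize p.1 (l i)) + if E i then 2 else 0) :
    ((∑ i ∈ Q, g i : ℕ) : ℝ) ≤ 4 * Real.logb 2 t.terminals.card + 2 := by
  have h1 := sum_sub_le_of_disjoint Q h l p.1.length _ (logSize_antitone hp) hhl hN hdisj
  have h2 : (∑ i ∈ Q, if E i then (2 : ℝ) else 0) ≤ 2 := by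
    rw [← Finset.sum_filter, Finset.sum_const, nsmul_eq_mul]
    have : (Q.filter E).card ≤ 1 := Finset.card_le_one.2 fun i hi j hj => by
      rw [Finset.mem_filter] at hi hj
      exact hE i hi.1 j hj.1 hi.2 hj.2
    have : ((Q.filter E).card : ℝ) ≤ 1 := by exact_mod_cast this
    linarith
  have h3 : t.logSize p.1 0 = Real.logb 2 t.terminals.card := by
    simp [logSize, subtree]
  have h4 : 0 ≤ t.logSize p.1 p.1.length := by
    rw [logSize_length List.prefix_rfl]
    exact Real.logb_nonneg (by norm_num)
      (by exact_mod_cast card_subtree_pos hp List.prefix_rfl)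
  calc ((∑ i ∈ Q, g i : ℕ) : ℝ) = ∑ i ∈ Q, (g i : ℝ) := by push_cast; rfl
    _ ≤ ∑ i ∈ Q, (4 * (t.logSize p.1 (h i) - t.logSize p.1 (l i)) + if E i then 2 else 0) :=
        Finset.sum_le_sum hg
    _ ≤ _ := by
        rw [Finset.sum_add_distrib, ← Finset.mul_sum]
        linarith

end Logs

end CompactTrie

/-- Exchanging the sums over trees and terminals, when occurrences are counted. -/
theorem sum_mul_count_le {ι β : Type*} (Q : Finset ι) (S : Finset β) (g f : ι → ℕ)
    (r : ι → β → Prop) [∀ i, DecidablePred (r i)]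
    (hf : ∀ i ∈ Q, f i ≤ ∑ p ∈ S, if r i p then 1 else 0) {B : ℝ}
    (hB : ∀ p ∈ S, ((∑ i ∈ Q.filter (r · p), g i : ℕ) : ℝ) ≤ B) :
    ((∑ i ∈ Q, g i * f i : ℕ) : ℝ) ≤ B * S.card := by
  have h : ∑ i ∈ Q, g i * f i ≤ ∑ p ∈ S, ∑ i ∈ Q.filter (r · p), g i := by
    calc ∑ i ∈ Q, g i * f i ≤ ∑ i ∈ Q, ∑ p ∈ S, if r i p then g i else 0 :=
          Finset.sum_le_sum fun i hi => (Nat.mul_le_mul_left _ (hf i hi)).trans_eq (by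
            rw [Finset.mul_sum]; simp)
      _ = _ := by
          rw [Finset.sum_comm]
          exact Finset.sum_congr rfl fun p _ => (Finset.sum_filter _ _).symm
  calc ((∑ i ∈ Q, g i * f i : ℕ) : ℝ) ≤ ((∑ p ∈ S, ∑ i ∈ Q.filter (r · p), g i : ℕ) : ℝ) :=
        Nat.cast_le.2 h
    _ = ∑ p ∈ S, ((∑ i ∈ Q.filter (r · p), g i : ℕ) : ℝ) := Nat.cast_sum _ _
    _ ≤ ∑ p ∈ S, B := Finset.sum_le_sum hB
    _ = B * S.card := by rw [Finset.sum_const, nsmul_eq_mul, mul_comm]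

/-! ### Occurrences of a label in the next level -/

section Counting

open CompactTrie

variable {α : Type*} [LinearOrder α] {t : CompactTrie α} {heavy : Str α → WithBot α}

theorem card_filter_substNode_le (v : Str α) (a : WithBot α) (l : ℕ) :
    ((t.substNode v a).filter (·.2 = l)).card ≤
      ∑ p ∈ t.terminals.filter (·.2 = l), if v ++ [a] <+: p.1 then 1 else 0 := by
  rw [substNode, Finset.filter_image, ← Finset.card_filter, Finset.filter_filter]
  refine Finset.card_image_le.trans (Finset.card_le_card fun p hp => ?_)
  rw [Finset.mem_filter, mem_subtree] at hp
  exact Finset.mem_filter.2 ⟨hp.1.1, hp.2, hp.1.2⟩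

open Classical in
-- A terminal is counted once even though all off-path subtrees at `v` are merged, since it lies in
-- at most one of them.
theorem card_filter_substPath_le (s v : Str α) (l : ℕ) :
    ((t.substPath heavy s v).filter (·.2 = l)).card ≤
      ∑ p ∈ t.terminals.filter (·.2 = l),
        if ∃ a ∈ t.offChars heavy v, v ++ [a] <+: p.1 then 1 else 0 := by
  rw [substPath, Finset.filter_biUnion, ← Finset.card_filter]
  refine Finset.card_biUnion_le.trans ?_
  calc ∑ a ∈ t.offChars heavy v, ((((t.substNode v a).image fun p =>
          (v.drop s.length ++ heavy v :: p.1.tail, p.2)).filter (·.2 = l)).card)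
      ≤ ∑ a ∈ t.offChars heavy v,
          ((t.subtree (v ++ [a])).filter (·.2 = l)).card := Finset.sum_le_sum fun a _ => by
        rw [Finset.filter_image]
        refine Finset.card_image_le.trans ?_
        rw [substNode, Finset.filter_image]
        exact Finset.card_image_le
    _ = ((t.offChars heavy v).biUnion fun a =>
          (t.subtree (v ++ [a])).filter (·.2 = l)).card :=
        (Finset.card_biUnion fun a _ b _ hab => Finset.disjoint_filter_filter
          (disjoint_subtree_children hab)).symm
    _ ≤ _ := by
        refine Finset.card_le_card fun p hp => ?_
        obtain ⟨a, ha, hp⟩ := Finset.mem_biUnion.1 hp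
        rw [Finset.mem_filter, mem_subtree] at hp
        exact Finset.mem_filter.2 ⟨Finset.mem_filter.2 ⟨hp.1.1, hp.2⟩, a, ha, hp.1.2⟩

theorem occ_groupNode_le (hh : t.IsHeavy heavy) {FN : Str α → Finset (Finset (WithBot α))}
    (hFN : ∀ v ∈ t.explicit, IsGrouping (t.offChars heavy v) id (t.substNode v) (FN v)) (l : ℕ) :
    ((∑ v ∈ t.explicit, ∑ G ∈ FN v, (groupNode t v G).occ l : ℕ) : ℝ) ≤
      (4 * Real.logb 2 t.terminals.card + 2) * t.occ l := by
  classical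
  have h1 : ∑ v ∈ t.explicit, ∑ G ∈ FN v, (groupNode t v G).occ l ≤
      ∑ x ∈ t.explicit.sigma fun v => t.offChars heavy v,
        ((FN x.1).filter (x.2 ∈ ·)).card * ((t.substNode x.1 x.2).filter (·.2 = l)).card := by
    rw [Finset.sum_sigma]
    exact Finset.sum_le_sum fun v hv => (hFN v hv).sum_card_filter_le (·.2 = l)
  refine (Nat.cast_le.2 h1).trans (sum_mul_count_le _ (t.terminals.filter (·.2 = l)) _ _
    (fun x p => x.1 ++ [x.2] <+: p.1) (fun x _ => card_filter_substNode_le x.1 x.2 l) ?_)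
  intro p hp
  have hp := (Finset.mem_filter.1 hp).1
  -- For type (a) the stretch is the first character of the edge, from depth |v| to |v| + 1.
  refine sum_le_log hp _ (fun x => x.1.length) (fun x => x.1.length + 1) _
    (fun x => t.InnerMain x.1) (fun _ _ => Nat.le_succ _) ?_ ?_ ?_ ?_
  · intro x hx
    simpa using (Finset.mem_filter.1 hx).2.length_le
  · rintro ⟨v, a⟩ hx ⟨w, b⟩ hy hne
    simp only [Finset.mem_filter, Finset.mem_sigma] at hx hy
    rcases lt_trichotomy v.length w.length with h | h | h
    · exact Or.inl h
    · obtain rfl : v = w := (List.prefix_of_prefix_length_le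
        (prefix_of_append_singleton_prefix hx.2) (prefix_of_append_singleton_prefix hy.2)
        h.le).eq_of_length h
      exact absurd (by rw [append_singleton_prefix_inj hx.2 hy.2]) hne
    · exact Or.inr h
  · rintro ⟨v, a⟩ hx ⟨w, b⟩ hy hm hm'
    simp only [Finset.mem_filter, Finset.mem_sigma] at hx hy
    obtain rfl : v = w := hh.innerMain_unique hx.1.1 hx.1.2 hx.2 hm hy.1.1 hy.1.2 hy.2 hm'
    rw [append_singleton_prefix_inj hx.2 hy.2]
  · rintro ⟨v, a⟩ hx
    simp only [Finset.mem_filter, Finset.mem_sigma] at hx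
    have hl := logSize_length (t := t) hx.2
    rw [List.length_append, List.length_singleton] at hl
    rw [hl, logSize_length (prefix_of_append_singleton_prefix hx.2)]
    exact (hFN v hx.1.1).card_le_log hx.1.2 (card_substNode v a).ge
      (card_biUnion_substNode_le v _) (card_subtree_pos hp hx.2)
      (Finset.card_le_card (subtree_anti (List.prefix_append _ _)))
      (hh.two_mul_card_le hx.1.1 hx.1.2)

theorem occ_groupPath_le (hh : t.IsHeavy heavy)
    {FP : Str α × Str α → Finset (Finset (Str α))}
    (hFP : ∀ q ∈ t.heavyPaths heavy,
      IsGrouping (t.offNodes heavy q.1 q.2) List.length (t.substPath heavy q.1) (FP q)) (l : ℕ) :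
    ((∑ q ∈ t.heavyPaths heavy, ∑ G ∈ FP q, (groupPath t heavy q.1 q.2 G).occ l : ℕ) : ℝ) ≤
      (4 * Real.logb 2 t.terminals.card + 2) * t.occ l := by
  classical
  have h1 : ∑ q ∈ t.heavyPaths heavy, ∑ G ∈ FP q, (groupPath t heavy q.1 q.2 G).occ l ≤
      ∑ x ∈ (t.heavyPaths heavy).sigma fun q => t.offNodes heavy q.1 q.2,
        ((FP x.1).filter (x.2 ∈ ·)).card *
          ((t.substPath heavy x.1.1 x.2).filter (·.2 = l)).card := by
    rw [Finset.sum_sigma]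
    exact Finset.sum_le_sum fun q hq => (hFP q hq).sum_card_filter_le (·.2 = l)
  refine (Nat.cast_le.2 h1).trans (sum_mul_count_le _ (t.terminals.filter (·.2 = l)) _ _
    (fun x p => ∃ a ∈ t.offChars heavy x.2, x.2 ++ [a] <+: p.1)
    (fun x _ => card_filter_substPath_le x.1.1 x.2 l) ?_)
  intro p hp
  have hp := (Finset.mem_filter.1 hp).1
  have hdisj : ∀ x ∈ ((t.heavyPaths heavy).sigma fun q => t.offNodes heavy q.1 q.2).filter
        (fun x => ∃ a ∈ t.offChars heavy x.2, x.2 ++ [a] <+: p.1),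
      ∀ y ∈ ((t.heavyPaths heavy).sigma fun q => t.offNodes heavy q.1 q.2).filter
        (fun x => ∃ a ∈ t.offChars heavy x.2, x.2 ++ [a] <+: p.1), x ≠ y →
      x.2.length + 1 ≤ y.1.1.length ∨ y.2.length + 1 ≤ x.1.1.length := by
    rintro ⟨⟨s, e⟩, v⟩ hx ⟨⟨s', e'⟩, w⟩ hy hne
    simp only [Finset.mem_filter, Finset.mem_sigma] at hx hy
    obtain ⟨hx, a, ha, hxp⟩ := hx
    obtain ⟨hy, b, hb, hyp⟩ := hy
    refine heavyPaths_stretch_disjoint hx.1 hx.2 ha hxp hy.1 hy.2 hb hyp fun h => hne ?_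
    simp only [Prod.mk.injEq] at h
    obtain ⟨rfl, rfl, rfl⟩ := h
    rfl
  -- For type (b) the stretch runs from the start of the heavy path to one character past `v`, since
  -- the size `m` is taken below the edge that leaves the path.
  refine sum_le_log hp _ (fun x => x.1.1.length) (fun x => x.2.length + 1) _
    (fun x => t.InnerMain x.2) ?_ ?_ hdisj ?_ ?_
  · intro x hx
    simp only [Finset.mem_filter, Finset.mem_sigma] at hx
    exact (mem_offNodes.1 hx.1.2).2.1.length_le.trans (Nat.le_succ _)
  · intro x hx
    obtain ⟨a, -, h⟩ := (Finset.mem_filter.1 hx).2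
    simpa using h.length_le
  · intro x hx y hy hm hm'
    by_contra hne
    have hd := hdisj x hx y hy hne
    simp only [Finset.mem_filter, Finset.mem_sigma] at hx hy
    obtain ⟨hx, a, ha, hxp⟩ := hx
    obtain ⟨hy, b, hb, hyp⟩ := hy
    have hxn := mem_offNodes.1 hx.2
    have hyn := mem_offNodes.1 hy.2
    have hxy := hh.innerMain_unique hxn.1 ha hxp hm hyn.1 hb hyp hm'
    have h1 := hxn.2.1.length_le
    have h2 := hyn.2.1.length_le
    -- With the same node, both stretches contain its depth, against their disjointness.
    rw [hxy] at h1 hd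
    omega
  · rintro ⟨⟨s, e⟩, v⟩ hx
    simp only [Finset.mem_filter, Finset.mem_sigma] at hx
    obtain ⟨hx, a, ha, hxp⟩ := hx
    have hl := logSize_length (t := t) hxp
    have hn := mem_offNodes.1 hx.2
    have hvp := prefix_of_append_singleton_prefix hxp
    rw [List.length_append, List.length_singleton] at hl
    rw [hl, logSize_length (hn.2.1.trans hvp)]
    have hsub := Finset.card_le_card (subtree_anti (t := t) hn.2.1)
    exact (hFP _ hx.1).card_le_log hx.2 (card_subtree_le_card_substPath s ha)
      (card_biUnion_substPath_le hx.1 subset_rfl) (card_subtree_pos hp hxp)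
      ((Finset.card_le_card (subtree_anti (List.prefix_append _ _))).trans hsub)
      fun hm => (hh.two_mul_card_le hn.1 ha hm).trans hsub

/-- This keeps the logarithmic factor of every later level below that of `R`. -/
theorem Forms.card_terminals_le {B : Multiset (CompactTrie α)} (h : Forms t B) :
    ∀ t' ∈ B, t'.terminals.card ≤ t.terminals.card := by
  obtain ⟨heavy, FN, FP, -, -, hFP, rfl⟩ := h
  have hsub : ∀ v, (t.subtree v).card ≤ t.terminals.card := fun v =>
    Finset.card_le_card (Finset.filter_subset _ _)
  intro t' ht'
  simp only [Multiset.mem_add, Multiset.mem_sum, Multiset.mem_map, Finset.mem_val] at ht'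
  rcases ht' with ⟨v, -, G, -, rfl⟩ | ⟨q, hq, G, hG, rfl⟩
  · exact (card_biUnion_substNode_le v G).trans (hsub v)
  · exact (card_biUnion_substPath_le hq ((hFP q hq).subset G hG)).trans (hsub _)

theorem Forms.sum_occ_le {B : Multiset (CompactTrie α)} (h : Forms t B) (l : ℕ) :
    (((B.map fun t' => t'.occ l).sum : ℕ) : ℝ) ≤
      (8 * Real.logb 2 t.terminals.card + 4) * t.occ l := by
  obtain ⟨heavy, FN, FP, hh, hFN, hFP, rfl⟩ := h
  have h1 := occ_groupNode_le hh hFN l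
  have h2 := occ_groupPath_le hh hFP l
  have hs : ∀ {ι γ : Type _} (S : Finset ι) (F : ι → Finset γ) (g : ι → γ → CompactTrie α),
      ((∑ i ∈ S, (F i).val.map (g i)).map fun t' => t'.occ l).sum =
        ∑ i ∈ S, ∑ G ∈ F i, (g i G).occ l := by
    intro ι γ S F g
    have := map_sum (Multiset.sumAddMonoidHom.comp
      (Multiset.mapAddMonoidHom fun t' : CompactTrie α => t'.occ l))
      (fun i => (F i).val.map (g i)) S
    refine this.trans (Finset.sum_congr rfl fun i _ => ?_)
    exact congrArg Multiset.sum (Multiset.map_map (fun t' : CompactTrie α => t'.occ l) (g i) _)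
  rw [Multiset.map_add, Multiset.sum_add, hs, hs, Nat.cast_add]
  linarith

theorem sum_map_sum_le {γ : Type*} (f : γ → ℕ) (c : ℝ) (P : Multiset (γ × Multiset γ))
    (hP : ∀ p ∈ P, (((p.2.map f).sum : ℕ) : ℝ) ≤ c * f p.1) :
    (((((P.map Prod.snd).sum).map f).sum : ℕ) : ℝ) ≤ c * (((P.map Prod.fst).map f).sum : ℕ) := by
  induction P using Multiset.induction_on with
  | empty => simp
  | cons p P ih =>
    have h1 := hP p (Multiset.mem_cons_self p P)
    have h2 := ih fun q hq => hP q (Multiset.mem_cons_of_mem hq)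
    simp only [Multiset.map_cons, Multiset.sum_cons, Multiset.map_add, Multiset.sum_add,
      Nat.cast_add, mul_add]
    exact add_le_add h1 h2

/-! ### Induction over the levels -/

variable {k : ℕ} {T : List α} {R : Finset ℕ} {level : ℕ → Multiset (CompactTrie α)}

theorem IsErrataTree.card_terminals_le (h : IsErrataTree k T R level) {i : ℕ} (hi : i ≤ k) :
    ∀ t ∈ level i, t.terminals.card ≤ R.card := by
  induction i with
  | zero =>
    intro t ht
    rw [h.zero, Multiset.mem_singleton] at ht
    subst ht
    exact Finset.card_image_le
  | succ i ih =>
    obtain ⟨P, hP1, hP2, hP3⟩ := h.succ i hi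
    intro t ht
    rw [← hP3] at ht
    obtain ⟨B, hB, htB⟩ := Multiset.mem_join.1 ht
    obtain ⟨p, hp, rfl⟩ := Multiset.mem_map.1 hB
    exact ((hP2 p hp).card_terminals_le t htB).trans
      (ih (Nat.le_of_succ_le hi) p.1 (hP1 ▸ Multiset.mem_map_of_mem _ hp))

theorem IsErrataTree.sum_occ_le (h : IsErrataTree k T R level) (hR : 2 ≤ R.card) (l : ℕ)
    {i : ℕ} (hi : i ≤ k) :
    ((((level i).map fun t => t.occ l).sum : ℕ) : ℝ) ≤ (12 * Real.logb 2 R.card) ^ i := by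
  have hL : 1 ≤ Real.logb 2 R.card := by
    rw [Real.le_logb_iff_rpow_le (by norm_num) (by positivity)]
    exact_mod_cast hR
  induction i with
  | zero =>
    rw [h.zero]
    simp only [Multiset.map_singleton, Multiset.sum_singleton, pow_zero, Nat.cast_le_one]
    -- In the base trie the label determines the suffix.
    refine Finset.card_le_one.2 fun p hp q hq => ?_
    simp only [baseTrie, Finset.mem_filter, Finset.mem_image] at hp hq
    obtain ⟨⟨i, -, rfl⟩, rfl⟩ := hp
    obtain ⟨⟨j, -, rfl⟩, rfl⟩ := hq
    rfl
  | succ i ih =>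
    obtain ⟨P, hP1, hP2, hP3⟩ := h.succ i hi
    have hstep := sum_map_sum_le (fun t : CompactTrie α => t.occ l) (12 * Real.logb 2 R.card) P ?_
    · rw [hP1, hP3] at hstep
      refine hstep.trans ?_
      rw [pow_succ']
      exact mul_le_mul_of_nonneg_left (ih (Nat.le_of_succ_le hi)) (by linarith)
    · intro p hp
      refine ((hP2 p hp).sum_occ_le l).trans (mul_le_mul_of_nonneg_right ?_ (Nat.cast_nonneg _))
      have hle := h.card_terminals_le (Nat.le_of_succ_le hi) p.1
        (hP1 ▸ Multiset.mem_map_of_mem _ hp)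
      have : Real.logb 2 p.1.terminals.card ≤ Real.logb 2 R.card := by
        -- For a trie without terminals, `Real.logb 2 0` has the default value 0.
        rcases Nat.eq_zero_or_pos p.1.terminals.card with h0 | h0
        · rw [h0, Nat.cast_zero, Real.logb_zero]
          linarith
        · exact Real.logb_le_logb_of_le (by norm_num) (by exact_mod_cast h0)
            (Nat.cast_le.2 hle)
      linarith

end Counting

end Errata

theorem mainTheorem7 (k : ℕ) :
    ∃ C : ℝ, ∀ (α : Type*) [LinearOrder α] (T : List α) (R : Finset ℕ)
      (level : ℕ → Multiset (Errata.CompactTrie α)),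
      R ⊆ Finset.range T.length → 2 ≤ R.card → Errata.IsErrataTree k T R level →
      ∀ l ∈ R, (Errata.totalOcc k level l : ℝ) ≤ C * Real.logb 2 (R.card : ℝ) ^ k := by
  -- As log x ≥ 1, 8 log x + 4 ≤ 12 log x, and each of the k + 1 levels is bounded by (12 log x)^k.
  refine ⟨(k + 1) * 12 ^ k, fun α _ T R level _ hR h l _ => ?_⟩
  have hL : 1 ≤ Real.logb 2 R.card := by
    rw [Real.le_logb_iff_rpow_le (by norm_num) (by positivity)]
    exact_mod_cast hR
  rw [Errata.totalOcc, Nat.cast_sum]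
  calc ∑ i ∈ Finset.range (k + 1), ((((level i).map fun t => t.occ l).sum : ℕ) : ℝ)
      ≤ ∑ i ∈ Finset.range (k + 1), (12 * Real.logb 2 R.card) ^ k :=
        Finset.sum_le_sum fun i hi => by
          have hik : i ≤ k := Nat.lt_succ_iff.1 (Finset.mem_range.1 hi)
          exact (h.sum_occ_le hR l hik).trans (pow_le_pow_right₀ (by linarith) hik)
    _ = (k + 1) * 12 ^ k * Real.logb 2 R.card ^ k := by
        rw [Finset.sum_const, Finset.card_range, nsmul_eq_mul, mul_pow]
        push_cast
        ring
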